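/- Let $G$ be a finite commutative group, written additively, let $M\ge 1$ and $q\ge 0$ be integers, and consider the summation problem: given $q$ quantum queries to a uniformly random function $A:\{0,\dots,M-1\}\to G$, output $\sum_{x=0}^{M-1}A(x)$. A $q$-query quantum algorithm has an arbitrary finite-dimensional work register $z$, starts in a unit vector independent of $A$, applies $q$ queries, each followed by an arbitrary unitary independent of $A$, measures in the computational basis, and computes its output from the outcome by a fixed function. A query is either the phase query $|x,\xi,z\rangle\mapsto\xi(A(x))\,|x,\xi,z\rangle$, where $\xi$ ranges over the characters of $G$, or the controlled-add query $|x,g,z\rangle\mapsto|x,g+A(x),z\rangle$. The success probability is taken over the random choice of $A$ and the measurement. Then, in each of the two query models, the maximum success probability of a $q$-query quantum algorithm exists. If $q<M$, it is exactly $$\min\left(\frac{\lfloor M/(M-q)\rfloor}{|G|},\,1\right),$$ and if $q\ge M$, it is $1$. In particular (the known parity bounds), if $|G|=2$, then it is $1/2$ for $q<M/2$ and $1$ for $q\ge M/2$. -/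

import Mathlib

/-!
Quantum query algorithms for a function `A : X → G`, where `X` is a finite set and `G` is a finite
commutative group. Basis states are triples `(x, r, z)`: a query register `x : X`, a response
register `r : R` and a work register `z : Z` of arbitrary finite size.
-/

universe u

noncomputable section

namespace QuantumQuery

/-- Vectors in the Hilbert space with orthonormal basis `|x, r, z⟩`. -/
abbrev StateSpace (X R Z : Type*) [Fintype X] [Fintype R] [Fintype Z] : Type _ :=
  EuclideanSpace ℂ (X × R × Z)

/-- The phase query `|x, ξ, z⟩ ↦ ξ (A x) |x, ξ, z⟩`; the response register holds a character of `G`.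
-/
def phaseQuery {X G Z : Type*} [Fintype X] [AddCommGroup G] [Fintype G] [Fintype Z] (A : X → G) :
    StateSpace X (AddChar G ℂ) Z →ₗ[ℂ] StateSpace X (AddChar G ℂ) Z where
  toFun ψ := WithLp.toLp 2 fun i => i.2.1 (A i.1) * ψ i
  map_add' φ ψ := by ext i; simp [mul_add]
  map_smul' c ψ := by ext i; simp [mul_left_comm]

/-- The controlled-add query `|x, g, z⟩ ↦ |x, g + A x, z⟩`: the amplitude of `|x, g, z⟩` after the
query is the amplitude of `|x, g - A x, z⟩` before it. -/
def addQuery {X G Z : Type*} [Fintype X] [AddCommGroup G] [Fintype G] [Fintype Z] (A : X → G) :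
    StateSpace X G Z →ₗ[ℂ] StateSpace X G Z where
  toFun ψ := WithLp.toLp 2 fun i => ψ (i.1, i.2.1 - A i.1, i.2.2)
  map_add' φ ψ := by ext i; simp
  map_smul' c ψ := by ext i; simp

/-- A quantum query algorithm with outputs in `S`: a unit vector as initial state, a unitary
`gate k` applied right after query number `k` (counted from `0`), and a measurement in the basis
`|x, r, z⟩` whose outcome is decoded by `out`. None of these data depends on the oracle. A run with
`q` queries uses the gates `gate 0, …, gate (q - 1)` only. -/
structure Algorithm (X R Z S : Type*) [Fintype X] [Fintype R] [Fintype Z] where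
  init : StateSpace X R Z
  norm_init : ‖init‖ = 1
  gate : ℕ → (StateSpace X R Z ≃ₗᵢ[ℂ] StateSpace X R Z)
  out : X × R × Z → S

namespace Algorithm

variable {X R Z S : Type*} [Fintype X] [Fintype R] [Fintype Z]

/-- The state after `q` queries, where `O` is the operator performing one query. -/
def state (alg : Algorithm X R Z S) (O : StateSpace X R Z →ₗ[ℂ] StateSpace X R Z) :
    ℕ → StateSpace X R Z
  | 0 => alg.init
  | k + 1 => alg.gate k (O (alg.state O k))

open Classical in
/-- The probability that the algorithm outputs `s` after `q` queries (Born rule). -/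
def outputProb (alg : Algorithm X R Z S) (O : StateSpace X R Z →ₗ[ℂ] StateSpace X R Z) (q : ℕ)
    (s : S) : ℝ :=
  ∑ i : X × R × Z, if alg.out i = s then ‖alg.state O q i‖ ^ 2 else 0

open Classical in
/-- The probability that the algorithm outputs `f A` after `q` queries to `A`, for `A : X → G`
uniformly random; `O A` is the operator performing one query to `A`. -/
def successProb {G : Type*} [Fintype G] (alg : Algorithm X R Z S)
    (O : (X → G) → StateSpace X R Z →ₗ[ℂ] StateSpace X R Z) (f : (X → G) → S) (q : ℕ) : ℝ :=
  (∑ A : X → G, alg.outputProb (O A) q (f A)) / (Fintype.card (X → G) : ℝ)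

end Algorithm

/-- The success probabilities of all `q`-query algorithms, with phase queries to a uniformly random
`A : {0, …, M - 1} → G`, at computing the sum of the values of `A`. -/
def phaseSumProbs (G : Type u) [AddCommGroup G] [Fintype G] (M q : ℕ) : Set ℝ :=
  {p | ∃ (Z : Type u) (_ : Fintype Z) (alg : Algorithm (Fin M) (AddChar G ℂ) Z G),
    p = alg.successProb (fun A : Fin M → G => phaseQuery A) (fun A => ∑ x, A x) q}

/-- The success probabilities of all `q`-query algorithms, with controlled-add queries to a
uniformly random `A : {0, …, M - 1} → G`, at computing the sum of the values of `A`. -/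
def addSumProbs (G : Type u) [AddCommGroup G] [Fintype G] (M q : ℕ) : Set ℝ :=
  {p | ∃ (Z : Type u) (_ : Fintype Z) (alg : Algorithm (Fin M) G Z G),
    p = alg.successProb (fun A : Fin M → G => addQuery A) (fun A => ∑ x, A x) q}

/-- In each of the two query models, the maximum success probability of a `q`-query algorithm at
the summation problem for functions `{0, …, M - 1} → G` exists and is equal to `p`. -/
def IsMaxSumProb (G : Type u) [AddCommGroup G] [Fintype G] (M q : ℕ) (p : ℝ) : Prop :=
  IsGreatest (phaseSumProbs G M q) p ∧ IsGreatest (addSumProbs G M q) p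

end QuantumQuery

end


/-!
In a suitable orthonormal basis of each of the two models, a query multiplies the basis vectors by
values `ξ (A x)`. After `q` queries every amplitude, as a function of `A`, is therefore a linear
combination of characters of `X → G` of weight at most `q`, that is, depending on at most `q`
values of `A`. Let `σ` be a homomorphism from `X → G` to a finite group `H`. Multiplying by the
indicator function of a fibre of `σ` replaces a coefficient by an average over its coset modulo the
characters `η ∘ σ`, so if no coset has more than `n` characters of weight at most `q`,
Cauchy–Schwarz and Parseval leave at most the fraction `n / |H|` of the square norm on the fibre.
Conversely, `q` queries can multiply each term of a uniform superposition by the value at `A` of its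
own character of weight at most `q`; doing this with `n` characters in one coset and measuring in
the Fourier basis gives success probability `n / |H|`.

When `σ` is the sum, the shift of a tuple `χ` of characters by `η` has weight at most `q` if and
only if `-η` occurs at least `|X| - q` times in `χ`, which, for `q < |X|`, can happen
for at most `⌊|X| / (|X| - q)⌋` characters `η`.
-/

namespace QuantumQuery

open Finset

section Weight

variable {X G K : Type*} [Fintype X] [DecidableEq X] [AddCommMonoid G] [CommMonoid K]

omit [Fintype X] [DecidableEq X] in
lemma addChar_map_sum (χ : AddChar G K) (s : Finset X) (A : X → G) :
    χ (∑ x ∈ s, A x) = ∏ x ∈ s, χ (A x) :=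
  map_prod χ.toMonoidHom (fun x => Multiplicative.ofAdd (A x)) s

/-- Characters of `X → G` as tuples of characters of `G`: the tuple `χ` stands for the character
`A ↦ ∏ x, χ x (A x)`. -/
noncomputable def components : AddChar (X → G) K ≃+ (X → AddChar G K) where
  toFun χ x := χ.compAddMonoidHom (AddMonoidHom.single (fun _ => G) x)
  invFun χ := ∑ x, (χ x).compAddMonoidHom (Pi.evalAddMonoidHom (fun _ => G) x)
  left_inv χ := by
    ext A
    simp only [AddChar.sum_apply, AddChar.compAddMonoidHom_apply, AddMonoidHom.single_apply,
      Pi.evalAddMonoidHom_apply, ← addChar_map_sum, univ_sum_single]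
  right_inv χ := by
    ext x g
    simp only [AddChar.compAddMonoidHom_apply, AddChar.sum_apply, Pi.evalAddMonoidHom_apply,
      AddMonoidHom.single_apply]
    rw [Fintype.prod_eq_single x fun y hy => by simp [hy], Pi.single_eq_same]
  map_add' _ _ := rfl

lemma components_apply (χ : AddChar (X → G) K) (x : X) (g : G) :
    components χ x g = χ (Pi.single x g) := rfl

lemma components_symm_apply (χ : X → AddChar G K) (A : X → G) :
    components.symm χ A = ∏ x, χ x (A x) :=
  AddChar.sum_apply ..

lemma components_symm_single_apply (x : X) (ξ : AddChar G K) (A : X → G) :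
    components.symm (Pi.single x ξ) A = ξ (A x) := by
  rw [components_symm_apply, Fintype.prod_eq_single x fun y hy => by simp [hy], Pi.single_eq_same]

lemma components_comp_sum (η : AddChar G K) :
    components (η.compAddMonoidHom (∑ x, Pi.evalAddMonoidHom (fun _ : X => G) x)) =
      Function.const X η := by
  ext x g
  simp [components_apply]

/-- The number of coordinates on which a character of `X → G` depends. -/
noncomputable def weight (χ : AddChar (X → G) K) : ℕ := hammingNorm (components χ)

lemma weight_zero : weight (0 : AddChar (X → G) K) = 0 := by
  rw [weight, map_zero, hammingNorm_zero]

lemma weight_add_single_le (χ : AddChar (X → G) K) (x : X) (ξ : AddChar G K) :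
    weight (χ + components.symm (Pi.single x ξ)) ≤ weight χ + 1 := by
  rw [weight, map_add, AddEquiv.apply_symm_apply]
  refine (card_le_card fun y hy => ?_).trans (card_insert_le x {y | components χ y ≠ 0})
  by_cases h : y = x
  · simp [h]
  · simpa [h] using hy

omit [Fintype X] [DecidableEq X] in
lemma exists_prod_range_eq_prod {T : Finset X} {q : ℕ} (hT : #T ≤ q) :
    ∃ p : ℕ → Option X, ∀ f : X → K, ∏ k ∈ range q, (p k).elim 1 f = ∏ x ∈ T, f x := by
  obtain ⟨r, rfl⟩ := Nat.exists_eq_add_of_le hT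
  refine ⟨fun k => if h : k < #T then some (T.equivFin.symm ⟨k, h⟩) else none, fun f => ?_⟩
  rw [prod_range_add, prod_range, ← prod_coe_sort T, ← Equiv.prod_comp T.equivFin.symm]
  simp

lemma exists_apply_eq_prod_range [Nonempty X] {χ : AddChar (X → G) K} {q : ℕ}
    (hχ : weight χ ≤ q) : ∃ (x : ℕ → X) (ξ : ℕ → AddChar G K),
      ∀ A : X → G, χ A = ∏ k ∈ range q, ξ k (A (x k)) := by
  obtain ⟨p, hp⟩ := exists_prod_range_eq_prod (K := K) hχ
  refine ⟨fun k => (p k).getD (Classical.arbitrary X), fun k => (p k).elim 0 (components χ),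
    fun A => ?_⟩
  calc χ A = ∏ x, components χ x (A x) := by
        rw [← components_symm_apply, AddEquiv.symm_apply_apply]
    _ = ∏ x with components χ x ≠ 0, components χ x (A x) := by
        symm
        refine prod_filter_of_ne fun x _ hx h => hx ?_
        rw [h, AddChar.zero_apply]
    _ = _ := by
        rw [← hp]
        refine prod_congr rfl fun k _ => ?_
        cases h : p k <;> simp [h]

end Weight

section Fourier

variable {Γ H : Type*} [AddCommGroup Γ] [Fintype Γ] [AddCommGroup H] [Fintype H]

/-- The normalised joint eigenvector of all translations of `Γ` with eigenvalues `ψ a`; the sign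
of the exponent makes `g ↦ w (g - a)` multiply `w` by `ψ a`. -/
noncomputable def fourierVector (ψ : AddChar Γ ℂ) : EuclideanSpace ℂ Γ :=
  WithLp.toLp 2 fun g => (√(Fintype.card Γ : ℝ) : ℂ)⁻¹ * ψ (-g)

lemma apply_mul_fourierVector (ψ : AddChar Γ ℂ) (g : Γ) :
    ψ g * fourierVector ψ g = (√(Fintype.card Γ : ℝ) : ℂ)⁻¹ := by
  rw [fourierVector, mul_left_comm, ← AddChar.map_add_eq_mul, add_neg_cancel,
    AddChar.map_zero_eq_one, mul_one]

lemma ofReal_sqrt_natCast_mul_self (n : ℕ) : (√(n : ℝ) : ℂ) * √(n : ℝ) = n := by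
  exact_mod_cast Real.mul_self_sqrt (Nat.cast_nonneg _)

lemma orthonormal_fourierVector :
    Orthonormal ℂ (fourierVector : AddChar Γ ℂ → EuclideanSpace ℂ Γ) := by
  rw [orthonormal_iff_ite]
  intro ψ φ
  have hterm (g : Γ) : inner ℂ (fourierVector ψ g) (fourierVector φ g) =
      (Fintype.card Γ : ℂ)⁻¹ * (ψ - φ) g := by
    simp only [fourierVector, RCLike.inner_apply, map_mul, map_inv₀, Complex.conj_ofReal,
      AddChar.sub_apply, ← AddChar.map_neg_eq_conj, neg_neg, ← ofReal_sqrt_natCast_mul_self]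
    ring
  simp_rw [PiLp.inner_apply, hterm, ← mul_sum, AddChar.sum_eq_ite, sub_eq_zero]
  split_ifs <;> simp

lemma norm_sq_sum_smul {𝕜 ι E : Type*} [RCLike 𝕜] [Fintype ι] [NormedAddCommGroup E]
    [InnerProductSpace 𝕜 E] {v : ι → E} (hv : Orthonormal 𝕜 v) (a : ι → 𝕜) :
    ‖∑ i, a i • v i‖ ^ 2 = ∑ i, ‖a i‖ ^ 2 := by
  have h := hv.inner_sum a a univ
  simp only [inner_self_eq_norm_sq_to_K, RCLike.conj_mul] at h
  exact_mod_cast h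

lemma sum_norm_sq_sum_addChar (c : AddChar Γ ℂ → ℂ) :
    ∑ a, ‖∑ χ, c χ * χ a‖ ^ 2 = Fintype.card Γ * ∑ χ, ‖c χ‖ ^ 2 := by
  have hcoord (a : Γ) : ‖∑ χ, c χ * χ a‖ ^ 2 =
      Fintype.card Γ * ‖(∑ χ, c χ • fourierVector χ) (-a)‖ ^ 2 := by
    have h : (∑ χ, c χ • fourierVector χ) (-a) =
        (√(Fintype.card Γ : ℝ) : ℂ)⁻¹ * ∑ χ, c χ * χ a := by
      simp [fourierVector, mul_sum, mul_left_comm]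
    rw [h, norm_mul, mul_pow, norm_inv, Complex.norm_real, inv_pow, Real.norm_eq_abs, sq_abs,
      Real.sq_sqrt (Nat.cast_nonneg _), mul_inv_cancel_left₀ (by positivity)]
  rw [← norm_sq_sum_smul (E := EuclideanSpace ℂ Γ) orthonormal_fourierVector,
    EuclideanSpace.norm_sq_eq, sum_congr rfl fun a _ => hcoord a, ← mul_sum]
  congr 1
  exact Equiv.sum_comp (Equiv.neg Γ) fun a => ‖(∑ χ, c χ • fourierVector χ) a‖ ^ 2

lemma norm_sq_sum_le_of_card_support_le {ι : Type*} [Fintype ι] {s : Finset ι} {n : ℕ}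
    (hs : #s ≤ n) {f : ι → ℂ} (hf : ∀ i ∉ s, f i = 0) :
    ‖∑ i, f i‖ ^ 2 ≤ n * ∑ i, ‖f i‖ ^ 2 :=
  calc ‖∑ i, f i‖ ^ 2 = ‖∑ i ∈ s, f i‖ ^ 2 := by
        rw [sum_subset (subset_univ s) fun i _ hi => hf i hi]
    _ ≤ (∑ i ∈ s, ‖f i‖) ^ 2 := by gcongr; exact norm_sum_le ..
    _ ≤ #s * ∑ i ∈ s, ‖f i‖ ^ 2 := sq_sum_le_card_mul_sum_sq
    _ ≤ n * ∑ i, ‖f i‖ ^ 2 := by gcongr; exact subset_univ s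

omit [Fintype Γ] in
lemma ite_apply_eq_sum_addChar [Finite Γ] [DecidableEq H] (σ : Γ →+ H) (s : H)
    (c : AddChar Γ ℂ → ℂ) (a : Γ) :
    (if σ a = s then ∑ χ, c χ * χ a else 0) =
      ∑ χ, ((Fintype.card H : ℂ)⁻¹ * ∑ η : AddChar H ℂ, η s * c (χ + η.compAddMonoidHom σ)) *
        χ a := by
  have hshift (η : AddChar H ℂ) : η s * ∑ χ, c (χ + η.compAddMonoidHom σ) * χ a =
      η (s - σ a) * ∑ χ, c χ * χ a := by
    rw [← Equiv.sum_comp (Equiv.subRight (η.compAddMonoidHom σ)), mul_sum, mul_sum]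
    refine sum_congr rfl fun χ _ => ?_
    rw [Equiv.subRight_apply, sub_add_cancel, AddChar.sub_apply, AddChar.compAddMonoidHom_apply,
      map_neg, sub_eq_add_neg, AddChar.map_add_eq_mul]
    ring
  have horth : ∑ η : AddChar H ℂ, η (s - σ a) = if σ a = s then (Fintype.card H : ℂ) else 0 := by
    simp only [AddChar.sum_apply_eq_ite, sub_eq_zero, @eq_comm _ s]
  simp_rw [mul_sum, sum_mul, mul_assoc]
  rw [sum_comm]
  simp_rw [← mul_sum, hshift, ← sum_mul, horth]
  split_ifs <;> simp

omit [Fintype Γ] in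
lemma norm_sq_inv_card_mul_sum_le (σ : Γ →+ H) (s : H) {D : Finset (AddChar Γ ℂ)}
    {c : AddChar Γ ℂ → ℂ} (hc : ∀ χ ∉ D, c χ = 0) {χ : AddChar Γ ℂ} {n : ℕ}
    (hn : #{η : AddChar H ℂ | χ + η.compAddMonoidHom σ ∈ D} ≤ n) :
    ‖(Fintype.card H : ℂ)⁻¹ * ∑ η : AddChar H ℂ, η s * c (χ + η.compAddMonoidHom σ)‖ ^ 2 ≤
      n / Fintype.card H ^ 2 * ∑ η : AddChar H ℂ, ‖c (χ + η.compAddMonoidHom σ)‖ ^ 2 := by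
  have h := norm_sq_sum_le_of_card_support_le hn
    (f := fun η => η s * c (χ + η.compAddMonoidHom σ)) fun η hη => by
      rw [hc _ (by simpa using hη), mul_zero]
  simp only [norm_mul, AddChar.norm_apply, one_mul] at h
  rw [norm_mul, mul_pow, norm_inv, Complex.norm_natCast, inv_pow, div_mul_eq_mul_div,
    inv_mul_eq_div]
  gcongr

lemma sum_fiber_norm_sq_le [DecidableEq H] (σ : Γ →+ H) (s : H) {D : Finset (AddChar Γ ℂ)} {n : ℕ}
    (hn : ∀ χ, #{η : AddChar H ℂ | χ + η.compAddMonoidHom σ ∈ D} ≤ n)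
    {f : Γ → ℂ} (hf : f ∈ Submodule.span ℂ ((⇑) '' (D : Set (AddChar Γ ℂ)))) :
    ∑ a, (if σ a = s then ‖f a‖ ^ 2 else 0) ≤ n / Fintype.card H * ∑ a, ‖f a‖ ^ 2 := by
  obtain ⟨c, hc, rfl⟩ : ∃ c : AddChar Γ ℂ → ℂ, (∀ χ ∉ D, c χ = 0) ∧
      f = fun a => ∑ χ, c χ * χ a := by
    obtain ⟨c, rfl⟩ := (Submodule.mem_span_image_finset_iff_exists_fun' ℂ).1 hf
    refine ⟨fun χ => if χ ∈ D then c χ else 0, fun χ hχ => if_neg hχ, ?_⟩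
    ext a
    simp
  calc ∑ a, (if σ a = s then ‖∑ χ, c χ * χ a‖ ^ 2 else 0)
      = ∑ a, ‖if σ a = s then ∑ χ, c χ * χ a else 0‖ ^ 2 := by
        simp only [apply_ite norm, norm_zero, ite_pow, zero_pow two_ne_zero]
    _ ≤ Fintype.card Γ * ∑ χ, n / Fintype.card H ^ 2 *
          ∑ η : AddChar H ℂ, ‖c (χ + η.compAddMonoidHom σ)‖ ^ 2 := by
        simp_rw [ite_apply_eq_sum_addChar, sum_norm_sq_sum_addChar]
        gcongr with χ
        exact norm_sq_inv_card_mul_sum_le σ s hc (hn χ)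
    _ = Fintype.card Γ * (n / Fintype.card H ^ 2 * (Fintype.card H * ∑ χ, ‖c χ‖ ^ 2)) := by
        have hshift (η : AddChar H ℂ) :
            ∑ χ, ‖c (χ + η.compAddMonoidHom σ)‖ ^ 2 = ∑ χ, ‖c χ‖ ^ 2 :=
          Equiv.sum_comp (Equiv.addRight (η.compAddMonoidHom σ)) fun χ => ‖c χ‖ ^ 2
        rw [← mul_sum, sum_comm]
        simp [hshift]
    _ = n / Fintype.card H * ∑ a, ‖∑ χ, c χ * χ a‖ ^ 2 := by
        rw [sum_norm_sq_sum_addChar]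
        field_simp

end Fourier

section UpperBound

variable {X G R Z H : Type*} [Fintype X] [AddCommGroup G] [Fintype G]
  [Fintype R] [Fintype Z] [AddCommGroup H] [Fintype H]

/-- The functions of `A : X → G` that are linear combinations of characters depending on at most
`k` values of `A`. -/
def degreeLE (X G : Type*) [Fintype X] [DecidableEq X] [AddCommGroup G] [Fintype G] (k : ℕ) :
    Submodule ℂ ((X → G) → ℂ) :=
  Submodule.span ℂ ((⇑) '' {χ : AddChar (X → G) ℂ | weight χ ≤ k})

lemma const_mem_degreeLE [DecidableEq X] (c : ℂ) (k : ℕ) : (fun _ => c) ∈ degreeLE X G k := by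
  have h : ((0 : AddChar (X → G) ℂ) : (X → G) → ℂ) ∈ degreeLE X G k :=
    Submodule.subset_span (Set.mem_image_of_mem _ (weight_zero.trans_le (Nat.zero_le k)))
  convert (degreeLE X G k).smul_mem c h using 1
  ext A
  simp

lemma mul_mem_degreeLE [DecidableEq X] {k : ℕ} (x : X) (ξ : AddChar G ℂ) {f : (X → G) → ℂ}
    (hf : f ∈ degreeLE X G k) : (fun A => ξ (A x) * f A) ∈ degreeLE X G (k + 1) := by
  suffices h : degreeLE X G k ≤
      (degreeLE X G (k + 1)).comap (LinearMap.mulLeft ℂ fun A : X → G => ξ (A x)) from h hf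
  refine Submodule.span_le.2 ?_
  rintro _ ⟨χ, hχ, rfl⟩
  refine Submodule.subset_span ⟨χ + components.symm (Pi.single x ξ),
    (weight_add_single_le χ x ξ).trans (Nat.succ_le_succ hχ), ?_⟩
  ext A
  simp [components_symm_single_apply, mul_comm]

/-- A basis `b` labelled by positions, characters and work registers in which every query `O A` is
diagonal, the query at the label `(x, ξ, z)` being multiplication by `ξ (A x)`. Phase and
controlled-add queries only differ in the choice of this basis. -/
def IsQueryEigenbasis (b : OrthonormalBasis (X × AddChar G ℂ × Z) ℂ (StateSpace X R Z))
    (O : (X → G) → StateSpace X R Z →ₗ[ℂ] StateSpace X R Z) : Prop :=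
  ∀ A i, O A (b i) = i.2.1 (A i.1) • b i

namespace IsQueryEigenbasis

variable {b : OrthonormalBasis (X × AddChar G ℂ × Z) ℂ (StateSpace X R Z)}
  {O : (X → G) → StateSpace X R Z →ₗ[ℂ] StateSpace X R Z}

lemma apply_eq_sum (hb : IsQueryEigenbasis b O) (A : X → G) (ψ : StateSpace X R Z) :
    O A ψ = ∑ i, (i.2.1 (A i.1) * b.repr ψ i) • b i := by
  conv_lhs => rw [← b.sum_repr ψ, map_sum]
  simp only [map_smul, hb A, smul_smul, mul_comm]

lemma norm_apply (hb : IsQueryEigenbasis b O) (A : X → G) (ψ : StateSpace X R Z) :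
    ‖O A ψ‖ = ‖ψ‖ := by
  have h : ‖O A ψ‖ ^ 2 = ‖ψ‖ ^ 2 := by
    rw [hb.apply_eq_sum, norm_sq_sum_smul b.orthonormal, ← b.repr.norm_map,
      EuclideanSpace.norm_sq_eq]
    simp
  exact (sq_eq_sq₀ (norm_nonneg _) (norm_nonneg _)).1 h

lemma norm_state (hb : IsQueryEigenbasis b O) {S : Type*} (alg : Algorithm X R Z S) (A : X → G)
    (q : ℕ) : ‖alg.state (O A) q‖ = 1 := by
  induction q with
  | zero => exact alg.norm_init
  | succ k ih => rw [Algorithm.state, LinearIsometryEquiv.norm_map, hb.norm_apply, ih]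

lemma apply_state_mem_degreeLE [DecidableEq X] (hb : IsQueryEigenbasis b O) {S : Type*}
    (alg : Algorithm X R Z S) (q : ℕ) (φ : StateSpace X R Z →ₗ[ℂ] ℂ) :
    (fun A => φ (alg.state (O A) q)) ∈ degreeLE X G q := by
  induction q generalizing φ with
  | zero => exact const_mem_degreeLE (φ alg.init) 0
  | succ k ih =>
    have hstep (A : X → G) : φ (alg.state (O A) (k + 1)) =
        ∑ i, φ (alg.gate k (b i)) * (i.2.1 (A i.1) * b.repr (alg.state (O A) k) i) := by
      rw [Algorithm.state, hb.apply_eq_sum]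
      simp [mul_comm]
    have hcoord (i : X × AddChar G ℂ × Z) :
        (fun A => b.repr (alg.state (O A) k) i) ∈ degreeLE X G k :=
      ih (EuclideanSpace.projₗ i ∘ₗ b.repr.toLinearMap)
    rw [show (fun A => φ (alg.state (O A) (k + 1))) = ∑ i, φ (alg.gate k (b i)) •
      fun A => i.2.1 (A i.1) * b.repr (alg.state (O A) k) i from funext fun A => by simp [hstep]]
    exact Submodule.sum_mem _ fun i _ =>
      Submodule.smul_mem _ _ (mul_mem_degreeLE i.1 i.2.1 (hcoord i))

end IsQueryEigenbasis

/-- The number of characters of weight at most `q` in the coset of `χ` modulo the characters that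
factor through `σ`. Its largest value, divided by the order of `H`, is the optimal probability of
finding `σ A` with `q` queries to `A`. -/
noncomputable def coverage [DecidableEq X] (σ : (X → G) →+ H) (q : ℕ) (χ : AddChar (X → G) ℂ) : ℕ :=
  #{η : AddChar H ℂ | weight (χ + η.compAddMonoidHom σ) ≤ q}

omit [AddCommGroup G] [AddCommGroup H] [Fintype H] in
lemma Algorithm.successProb_eq [DecidableEq X] (alg : Algorithm X R Z H)
    (O : (X → G) → StateSpace X R Z →ₗ[ℂ] StateSpace X R Z) (f : (X → G) → H) (q : ℕ) :
    alg.successProb O f q =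
      (∑ A : X → G, alg.outputProb (O A) q (f A)) / (Fintype.card (X → G) : ℝ) := by
  unfold Algorithm.successProb
  congr!

lemma IsQueryEigenbasis.successProb_le [DecidableEq X]
    {b : OrthonormalBasis (X × AddChar G ℂ × Z) ℂ (StateSpace X R Z)}
    {O : (X → G) → StateSpace X R Z →ₗ[ℂ] StateSpace X R Z} (hb : IsQueryEigenbasis b O)
    (alg : Algorithm X R Z H) {σ : (X → G) →+ H} {q n : ℕ} (hn : ∀ χ, coverage σ q χ ≤ n) :
    alg.successProb O σ q ≤ n / Fintype.card H := by
  classical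
  have hcard : (0 : ℝ) < Fintype.card (X → G) := by positivity
  have hfiber (i : X × R × Z) :
      ∑ A, (if σ A = alg.out i then ‖alg.state (O A) q i‖ ^ 2 else 0) ≤
        n / Fintype.card H * ∑ A, ‖alg.state (O A) q i‖ ^ 2 := by
    refine sum_fiber_norm_sq_le σ (alg.out i)
      (D := {χ : AddChar (X → G) ℂ | weight χ ≤ q}) (fun χ => ?_) ?_
    · simpa [coverage] using hn χ
    · simpa [degreeLE] using hb.apply_state_mem_degreeLE alg q (EuclideanSpace.projₗ i)
  rw [alg.successProb_eq, div_le_iff₀ hcard]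
  calc ∑ A, alg.outputProb (O A) q (σ A)
      = ∑ i, ∑ A, (if σ A = alg.out i then ‖alg.state (O A) q i‖ ^ 2 else 0) := by
        rw [sum_comm]
        simp only [Algorithm.outputProb, eq_comm]
    _ ≤ ∑ i, n / Fintype.card H * ∑ A, ‖alg.state (O A) q i‖ ^ 2 := by
        gcongr with i
        exact hfiber i
    _ = n / Fintype.card H * ∑ A, ‖alg.state (O A) q‖ ^ 2 := by
        rw [← mul_sum, sum_comm]
        simp only [EuclideanSpace.norm_sq_eq]
    _ = n / Fintype.card H * Fintype.card (X → G) := by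
        simp only [hb.norm_state alg, one_pow, sum_const, card_univ, nsmul_eq_mul, mul_one]

end UpperBound

section LowerBound

lemma exists_linearIsometryEquiv_apply_eq {𝕜 ι E : Type*} [RCLike 𝕜] [NormedAddCommGroup E]
    [InnerProductSpace 𝕜 E] [FiniteDimensional 𝕜 E] {u v : ι → E} (hu : Orthonormal 𝕜 u)
    (hv : Orthonormal 𝕜 v) : ∃ U : E ≃ₗᵢ[𝕜] E, ∀ i, U (u i) = v i := by
  let b := Module.Basis.span hu.linearIndependent
  have hb (i : ι) : (b i : E) = u i :=
    congrArg Subtype.val (Module.Basis.span_apply hu.linearIndependent i)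
  have hon : Orthonormal 𝕜 b := by
    have h : Orthonormal 𝕜 fun i => (b i : E) := by simpa only [hb] using hu
    exact h.codRestrict _ _
  let L := (b.constr 𝕜 v).isometryOfOrthonormal hon (by
    convert hv
    ext i
    simp)
  refine ⟨L.extend.toLinearIsometryEquiv rfl, fun i => ?_⟩
  have h := L.extend_apply (b i)
  simpa [L, hb] using h

variable {X G R Z H ι : Type*} [Fintype X] [Fintype R] [Fintype Z] [Fintype ι]

lemma exists_algorithm_state_eq_sum {S : Type*} {u : ℕ → ι → StateSpace X R Z}
    (hu : ∀ k, Orthonormal ℂ (u k)) {a : ι → ℂ} (ha : ∑ i, ‖a i‖ ^ 2 = 1) (out : X × R × Z → S) :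
    ∃ alg : Algorithm X R Z S, alg.out = out ∧
      ∀ (O : StateSpace X R Z →ₗ[ℂ] StateSpace X R Z) (c : ℕ → ι → ℂ) (q : ℕ),
        (∀ k < q, ∀ i, O (u k i) = c k i • u k i) →
        alg.state O q = ∑ i, (a i * ∏ k ∈ range q, c k i) • u q i := by
  choose U hU using fun k => exists_linearIsometryEquiv_apply_eq (hu k) (hu (k + 1))
  have hnorm : ‖∑ i, a i • u 0 i‖ = 1 := by
    rw [← sq_eq_sq₀ (norm_nonneg _) zero_le_one, norm_sq_sum_smul (hu 0), ha, one_pow]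
  refine ⟨⟨_, hnorm, U, out⟩, rfl, fun O c q h => ?_⟩
  induction q with
  | zero => simp [Algorithm.state]
  | succ k ih =>
    rw [Algorithm.state, ih fun j hj => h j (hj.trans k.lt_succ_self)]
    simp only [map_sum, map_smul, h k k.lt_succ_self, hU, smul_smul, prod_range_succ, mul_assoc]

omit [Fintype ι] in
lemma Algorithm.norm_sq_state_le_outputProb {S : Type*} (alg : Algorithm X R Z S)
    (O : StateSpace X R Z →ₗ[ℂ] StateSpace X R Z) (q : ℕ) {i : X × R × Z} {s : S}
    (hi : alg.out i = s) : ‖alg.state O q i‖ ^ 2 ≤ alg.outputProb O q s := by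
  classical
  rw [Algorithm.outputProb, ← sum_filter]
  exact single_le_sum (f := fun i => ‖alg.state O q i‖ ^ 2) (fun i _ => by positivity)
    (by simpa using hi)

/-- The product state `u ⊗ w ⊗ v` of the query, response and work registers. -/
noncomputable def prodState (u : EuclideanSpace ℂ X) (w : EuclideanSpace ℂ R)
    (v : EuclideanSpace ℂ Z) : StateSpace X R Z :=
  WithLp.toLp 2 fun i => u i.1 * w i.2.1 * v i.2.2

lemma inner_prodState (u u' : EuclideanSpace ℂ X) (w w' : EuclideanSpace ℂ R)
    (v v' : EuclideanSpace ℂ Z) :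
    inner ℂ (prodState u w v) (prodState u' w' v') =
      inner ℂ u u' * inner ℂ w w' * inner ℂ v v' := by
  simp only [PiLp.inner_apply, prodState, Fintype.sum_prod_type, RCLike.inner_apply, map_mul]
  rw [sum_mul_sum, sum_mul]
  simp_rw [sum_mul_sum]
  refine sum_congr rfl fun x _ => sum_congr rfl fun r _ => sum_congr rfl fun z _ => ?_
  ring

omit [Fintype ι] in
lemma orthonormal_prodState {α β γ : Type*} {u : α → EuclideanSpace ℂ X}
    {w : β → EuclideanSpace ℂ R} {v : γ → EuclideanSpace ℂ Z} (hu : Orthonormal ℂ u)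
    (hw : Orthonormal ℂ w) (hv : Orthonormal ℂ v) :
    Orthonormal ℂ fun i : α × β × γ => prodState (u i.1) (w i.2.1) (v i.2.2) := by
  classical
  rw [orthonormal_iff_ite] at *
  rintro ⟨i, j, k⟩ ⟨i', j', k'⟩
  rw [inner_prodState, hu, hw, hv]
  simp only [Prod.mk.injEq, ite_and, ite_mul, one_mul, zero_mul]

variable [AddCommGroup G] [Fintype G] [AddCommGroup H] [Fintype H]

lemma isQueryEigenbasis_phaseQuery :
    IsQueryEigenbasis (EuclideanSpace.basisFun _ ℂ)
      (phaseQuery : (X → G) → StateSpace X (AddChar G ℂ) Z →ₗ[ℂ] StateSpace X (AddChar G ℂ) Z) := by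
  classical
  intro A i
  ext j
  by_cases h : j = i <;> simp [phaseQuery, h]

lemma addQuery_prodState_single [DecidableEq X] (A : X → G) (x : X) (ξ : AddChar G ℂ)
    (v : EuclideanSpace ℂ Z) :
    addQuery A (prodState (EuclideanSpace.single x 1) (fourierVector ξ) v) =
      ξ (A x) • prodState (EuclideanSpace.single x 1) (fourierVector ξ) v := by
  ext ⟨y, g, z⟩
  by_cases h : y = x
  · simp [addQuery, prodState, fourierVector, h, sub_eq_add_neg, AddChar.map_add_eq_mul]
    ring
  · simp [addQuery, prodState, h]

lemma exists_isQueryEigenbasis_addQuery :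
    ∃ b, IsQueryEigenbasis b
      (addQuery : (X → G) → StateSpace X G Z →ₗ[ℂ] StateSpace X G Z) := by
  classical
  have hcard : Module.finrank ℂ (StateSpace X G Z) = Fintype.card (X × AddChar G ℂ × Z) := by
    simp [AddChar.card_eq]
  have hon := orthonormal_prodState (EuclideanSpace.orthonormal_single (𝕜 := ℂ) (ι := X))
    (orthonormal_fourierVector (Γ := G)) (EuclideanSpace.orthonormal_single (𝕜 := ℂ) (ι := Z))
  refine ⟨OrthonormalBasis.mk hon
    (hon.linearIndependent.span_eq_top_of_card_eq_finrank' hcard.symm).ge, fun A i => ?_⟩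
  rw [OrthonormalBasis.coe_mk, addQuery_prodState_single]

namespace IsQueryEigenbasis

variable [DecidableEq X] [Nonempty X]
  {b : OrthonormalBasis (X × AddChar G ℂ × H) ℂ (StateSpace X R H)}
  {O : (X → G) → StateSpace X R H →ₗ[ℂ] StateSpace X R H}

lemma exists_algorithm_state_eq_sum (hb : IsQueryEigenbasis b O) {σ : (X → G) →+ H} {q : ℕ}
    {χ : AddChar (X → G) ℂ} {s : Finset (AddChar H ℂ)} (hs : s.Nonempty)
    (hq : ∀ η ∈ s, weight (χ + η.compAddMonoidHom σ) ≤ q)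
    {v : AddChar H ℂ → StateSpace X R H} (hv : Orthonormal ℂ v) {S : Type*}
    (out : X × R × H → S) :
    ∃ alg : Algorithm X R H S, alg.out = out ∧ ∀ A : X → G,
      alg.state (O A) q = ∑ η ∈ s, ((√(#s : ℝ) : ℂ)⁻¹ * (χ A * η (σ A))) • v η := by
  let e : AddChar H ℂ ≃ H := Fintype.equivOfCardEq AddChar.card_eq
  choose x ξ hxξ using fun η : s => exists_apply_eq_prod_range (hq η η.2)
  let u (k : ℕ) (η : s) : StateSpace X R H :=
    if k < q then b (x η k, ξ η k, e η) else v η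
  have hu (k : ℕ) : Orthonormal ℂ (u k) := by
    by_cases h : k < q
    · simp only [u, h, if_true]
      refine b.orthonormal.comp _ fun η η' hη => ?_
      simp only [Prod.mk.injEq, e.apply_eq_iff_eq] at hη
      exact Subtype.ext hη.2.2
    · simp only [u, h, if_false]
      exact hv.comp _ Subtype.val_injective
  have ha : ∑ _ : s, ‖(√(#s : ℝ) : ℂ)⁻¹‖ ^ 2 = 1 := by
    have : (0 : ℝ) < #s := by exact_mod_cast hs.card_pos
    simp [this.ne']
  obtain ⟨alg, hout, hstate⟩ := QuantumQuery.exists_algorithm_state_eq_sum hu ha out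
  refine ⟨alg, hout, fun A => ?_⟩
  rw [hstate (O A) (fun k η => ξ η k (A (x η k))) q
    (fun k hk η => by simp only [u, hk, if_true, hb A]), ← sum_coe_sort s]
  simp only [u, lt_irrefl, if_false, ← hxξ, AddChar.add_apply, AddChar.compAddMonoidHom_apply]

lemma exists_algorithm_norm_sq_state_eq [Nonempty R] (hb : IsQueryEigenbasis b O)
    {σ : (X → G) →+ H} {q : ℕ} {χ : AddChar (X → G) ℂ} (hχ : coverage σ q χ ≠ 0) :
    ∃ (alg : Algorithm X R H H) (x : X) (r : R), alg.out = (fun i => i.2.2) ∧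
      ∀ A, ‖alg.state (O A) q (x, r, σ A)‖ ^ 2 = coverage σ q χ / Fintype.card H := by
  classical
  obtain ⟨x⟩ := ‹Nonempty X›
  obtain ⟨r⟩ := ‹Nonempty R›
  let v (η : AddChar H ℂ) : StateSpace X R H :=
    prodState (EuclideanSpace.single x 1) (EuclideanSpace.single r 1) (fourierVector η)
  have hv : Orthonormal ℂ v :=
    (orthonormal_prodState (EuclideanSpace.orthonormal_single (𝕜 := ℂ) (ι := X))
      (EuclideanSpace.orthonormal_single (𝕜 := ℂ) (ι := R)) orthonormal_fourierVector).comp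
        (fun η => (x, r, η)) fun η η' h => by simpa using h
  obtain ⟨alg, hout, hstate⟩ := hb.exists_algorithm_state_eq_sum
    (card_ne_zero.1 hχ) (fun η hη => (mem_filter.1 hη).2) hv fun i => i.2.2
  have hamplitude (A : X → G) : alg.state (O A) q (x, r, σ A) = coverage σ q χ *
      ((√(coverage σ q χ : ℝ) : ℂ)⁻¹ * χ A * (√(Fintype.card H : ℝ) : ℂ)⁻¹) := by
    have hv_apply (η : AddChar H ℂ) : v η (x, r, σ A) = fourierVector η (σ A) := by
      simp [v, prodState]
    rw [hstate, coverage, ← nsmul_eq_mul, ← sum_const]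
    simp only [WithLp.ofLp_sum, WithLp.ofLp_smul, Finset.sum_apply, Pi.smul_apply, smul_eq_mul,
      hv_apply, mul_assoc, apply_mul_fourierVector]
  refine ⟨alg, x, r, hout, fun A => ?_⟩
  rw [hamplitude]
  simp only [norm_mul, AddChar.norm_apply, norm_inv, Complex.norm_natCast, Complex.norm_real,
    Real.norm_eq_abs, mul_one, mul_pow, inv_pow, sq_abs, Real.sq_sqrt (Nat.cast_nonneg _)]
  field_simp

lemma exists_algorithm_le_successProb [Nonempty R] (hb : IsQueryEigenbasis b O)
    {σ : (X → G) →+ H} {q : ℕ} {χ : AddChar (X → G) ℂ} (hχ : coverage σ q χ ≠ 0) :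
    ∃ alg : Algorithm X R H H,
      (coverage σ q χ / Fintype.card H : ℝ) ≤ alg.successProb O σ q := by
  obtain ⟨alg, x, r, hout, hnorm⟩ := hb.exists_algorithm_norm_sq_state_eq hχ
  have hcard : (0 : ℝ) < Fintype.card (X → G) := by positivity
  refine ⟨alg, ?_⟩
  rw [alg.successProb_eq, le_div_iff₀ hcard]
  calc (coverage σ q χ / Fintype.card H : ℝ) * Fintype.card (X → G)
      = ∑ A, ‖alg.state (O A) q (x, r, σ A)‖ ^ 2 := by simp [hnorm, mul_comm]
    _ ≤ ∑ A, alg.outputProb (O A) q (σ A) :=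
        sum_le_sum fun A _ => alg.norm_sq_state_le_outputProb (O A) q (congrFun hout _)

end IsQueryEigenbasis

end LowerBound

section HammingNorm

variable {X α : Type*} [Fintype X] [AddGroup α] [DecidableEq α]

lemma card_eq_neg_add_hammingNorm_add_const (χ : X → α) (η : α) :
    #{x | χ x = -η} + hammingNorm (χ + Function.const X η) = Fintype.card X := by
  simp_rw [hammingNorm, Pi.add_apply, Function.const_apply, ← add_eq_zero_iff_eq_neg]
  exact card_filter_add_card_filter_not _

variable [Fintype α]

lemma card_hammingNorm_add_const_le_mul_le (χ : X → α) (q : ℕ) :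
    #{η | hammingNorm (χ + Function.const X η) ≤ q} * (Fintype.card X - q) ≤ Fintype.card X :=
  calc #{η | hammingNorm (χ + Function.const X η) ≤ q} * (Fintype.card X - q)
      ≤ ∑ η with hammingNorm (χ + Function.const X η) ≤ q, #{x | χ x = -η} := by
        rw [← smul_eq_mul]
        refine card_nsmul_le_sum _ _ _ fun η hη => ?_
        have h := card_eq_neg_add_hammingNorm_add_const χ η
        have hη := (mem_filter.1 hη).2
        lia
    _ ≤ ∑ η : α, #{x | χ x = -η} := sum_le_univ_sum_of_nonneg fun _ => Nat.zero_le _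
    _ = ∑ η : α, #{x | -χ x = η} := by simp only [neg_eq_iff_eq_neg]
    _ = Fintype.card X := (card_eq_sum_card_fiberwise fun _ _ => mem_univ _).symm

lemma exists_le_card_hammingNorm_add_const_le_iff {q n : ℕ} :
    (∃ χ : X → α, n ≤ #{η | hammingNorm (χ + Function.const X η) ≤ q}) ↔
      n ≤ Fintype.card α ∧ n * (Fintype.card X - q) ≤ Fintype.card X := by
  constructor
  · rintro ⟨χ, hχ⟩
    exact ⟨hχ.trans (card_le_univ _),
      (Nat.mul_le_mul_right _ hχ).trans (card_hammingNorm_add_const_le_mul_le χ q)⟩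
  · rintro ⟨hα, hX⟩
    obtain ⟨e⟩ : Nonempty (Fin n ↪ α) := Function.Embedding.nonempty_of_card_le (by simpa)
    obtain ⟨f⟩ : Nonempty (Fin n × Fin (Fintype.card X - q) ↪ X) :=
      Function.Embedding.nonempty_of_card_le (by simpa)
    let χ : X → α := Function.extend f (fun p => -e p.1) 0
    have hχ (i : Fin n) : Fintype.card X - q ≤ #{x | χ x = -e i} := by
      refine (card_fin _).symm.trans_le (card_le_card_of_injOn (fun j => f (i, j)) ?_ ?_)
      · intro j _
        simp [χ, f.injective.extend_apply]
      · intro j _ j' _ h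
        simpa using h
    refine ⟨χ, (card_fin n).symm.trans_le (card_le_card_of_injOn e ?_ e.injective.injOn)⟩
    intro i _
    have h := card_eq_neg_add_hammingNorm_add_const χ (e i)
    have hi := hχ i
    simp only [coe_filter, mem_univ, true_and, Set.mem_ofPred_eq]
    lia

end HammingNorm

section Maximum

lemma isGreatest_successProb {X G R : Type*} {H : Type u} [Fintype X] [DecidableEq X]
    [AddCommGroup G] [Fintype G] [Fintype R] [AddCommGroup H] [Fintype H] [Nonempty X] [Nonempty R]
    {O : ∀ (Z : Type u) [Fintype Z], (X → G) → StateSpace X R Z →ₗ[ℂ] StateSpace X R Z}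
    (hO : ∀ (Z : Type u) [Fintype Z], ∃ b, IsQueryEigenbasis b (O Z))
    {σ : (X → G) →+ H} {q n : ℕ} (hn : IsGreatest (Set.range (coverage σ q)) n) :
    IsGreatest {p : ℝ | ∃ (Z : Type u) (_ : Fintype Z) (alg : Algorithm X R Z H),
      p = alg.successProb (O Z) σ q} (n / Fintype.card H) := by
  have hle (χ) : coverage σ q χ ≤ n := hn.2 ⟨χ, rfl⟩
  obtain ⟨⟨χ, rfl⟩, -⟩ := hn
  constructor
  · obtain ⟨b, hb⟩ := hO H
    have hzero : (0 : AddChar H ℂ).compAddMonoidHom σ = 0 := rfl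
    have hpos : 0 < coverage σ q (0 : AddChar (X → G) ℂ) :=
      card_pos.2 ⟨0, by simp [hzero, weight_zero]⟩
    obtain ⟨alg, halg⟩ := hb.exists_algorithm_le_successProb (hpos.trans_le (hle 0)).ne'
    exact ⟨H, _, alg, halg.antisymm (hb.successProb_le alg hle)⟩
  · rintro _ ⟨Z, _, alg, rfl⟩
    obtain ⟨b, hb⟩ := hO Z
    exact hb.successProb_le alg hle

lemma isGreatest_coverage_sum {X G : Type*} [Fintype X] [DecidableEq X] [AddCommGroup G]
    [Fintype G] {q n : ℕ}
    (hn : IsGreatest {k | k ≤ Fintype.card G ∧ k * (Fintype.card X - q) ≤ Fintype.card X} n) :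
    IsGreatest (Set.range (coverage (∑ x, Pi.evalAddMonoidHom (fun _ : X => G) x) q)) n := by
  have hcoverage (χ : X → AddChar G ℂ) :
      coverage (∑ x, Pi.evalAddMonoidHom (fun _ : X => G) x) q (components.symm χ) =
        #{η | hammingNorm (χ + Function.const X η) ≤ q} := by
    simp only [coverage, weight, map_add, AddEquiv.apply_symm_apply, components_comp_sum]
  simp only [← AddChar.card_eq (α := G), ← exists_le_card_hammingNorm_add_const_le_iff,
    ← hcoverage] at hn
  obtain ⟨⟨χ, hχ⟩, hmax⟩ := hn
  rw [← components.symm.surjective.range_comp]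
  exact ⟨⟨χ, (hmax ⟨χ, le_rfl⟩).antisymm hχ⟩, Set.forall_mem_range.2 fun χ => hmax ⟨χ, le_rfl⟩⟩

lemma isMaxSumProb_of_isGreatest {G : Type u} [AddCommGroup G] [Fintype G] {M q n : ℕ}
    (hM : 0 < M) (hn : IsGreatest {k | k ≤ Fintype.card G ∧ k * (M - q) ≤ M} n) :
    IsMaxSumProb G M q (n / Fintype.card G) := by
  have : Nonempty (Fin M) := ⟨⟨0, hM⟩⟩
  have hcoverage := isGreatest_coverage_sum (X := Fin M) (G := G) (q := q) (n := n) (by simpa)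
  have hphase := isGreatest_successProb (O := fun Z _ => phaseQuery)
    (fun Z _ => ⟨_, isQueryEigenbasis_phaseQuery⟩) hcoverage
  have hadd := isGreatest_successProb (O := fun Z _ => addQuery)
    (fun Z _ => exists_isQueryEigenbasis_addQuery) hcoverage
  have hsum : ⇑(∑ x, Pi.evalAddMonoidHom (fun _ : Fin M => G) x) = fun A => ∑ x, A x := by
    ext A
    simp
  rw [hsum] at hphase hadd
  exact ⟨hphase, hadd⟩

lemma isMaxSumProb_of_lt (G : Type u) [AddCommGroup G] [Fintype G] {M q : ℕ} (hq : q < M) :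
    IsMaxSumProb G M q ((min (M / (M - q)) (Fintype.card G) : ℕ) / Fintype.card G) := by
  have hmul (k : ℕ) : k * (M - q) ≤ M ↔ k ≤ M / (M - q) :=
    (Nat.le_div_iff_mul_le (Nat.sub_pos_of_lt hq)).symm
  refine isMaxSumProb_of_isGreatest (Nat.zero_lt_of_lt hq) ⟨?_, fun k hk => ?_⟩
  · exact ⟨min_le_right .., (hmul _).2 (min_le_left ..)⟩
  · exact le_min ((hmul k).1 hk.2) hk.1

lemma isMaxSumProb_of_le (G : Type u) [AddCommGroup G] [Fintype G] {M q : ℕ} (hM : 0 < M)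
    (hq : M ≤ q) : IsMaxSumProb G M q 1 := by
  have hG : (Fintype.card G : ℝ) ≠ 0 := by exact_mod_cast Fintype.card_ne_zero
  rw [← div_self hG]
  refine isMaxSumProb_of_isGreatest hM ⟨⟨le_rfl, ?_⟩, fun k hk => hk.1⟩
  simp [Nat.sub_eq_zero_of_le hq]

lemma floor_div_sub_eq {M q : ℕ} (hq : q < M) :
    (⌊(M : ℝ) / ((M : ℝ) - (q : ℝ))⌋ : ℝ) = (M / (M - q) : ℕ) := by
  rw [← Nat.cast_sub hq.le, ← natCast_floor_eq_intCast_floor (by positivity),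
    Nat.floor_div_eq_div]

end Maximum

end QuantumQuery

theorem theorem5p1 (G : Type u) [AddCommGroup G] [Fintype G] (M q : ℕ) (hM : 0 < M) :
    (q < M → QuantumQuery.IsMaxSumProb G M q
      (min ((⌊(M : ℝ) / ((M : ℝ) - (q : ℝ))⌋ : ℝ) / (Fintype.card G : ℝ)) 1)) ∧
    (M ≤ q → QuantumQuery.IsMaxSumProb G M q 1) ∧
    (Fintype.card G = 2 → 2 * q < M → QuantumQuery.IsMaxSumProb G M q (1 / 2)) ∧
    (Fintype.card G = 2 → M ≤ 2 * q → QuantumQuery.IsMaxSumProb G M q 1) := by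
  refine ⟨fun hq => ?_, QuantumQuery.isMaxSumProb_of_le G hM, fun hG hq => ?_, fun hG hq => ?_⟩
  · have hG : (0 : ℝ) < Fintype.card G := by exact_mod_cast Fintype.card_pos
    have h := QuantumQuery.isMaxSumProb_of_lt G hq
    rwa [Nat.cast_min, ← min_div_div_right hG.le, div_self hG.ne',
      ← QuantumQuery.floor_div_sub_eq hq] at h
  · have h := QuantumQuery.isMaxSumProb_of_lt G (M := M) (q := q) (by lia)
    have hdiv : M / (M - q) = 1 := by
      rw [Nat.div_eq_iff (by lia)]
      lia
    simpa [hdiv, hG] using h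
  · obtain hqM | hqM := lt_or_ge q M
    · have h := QuantumQuery.isMaxSumProb_of_lt G hqM
      have hdiv : 2 ≤ M / (M - q) := (Nat.le_div_iff_mul_le (by lia)).2 (by lia)
      simpa [hG, min_eq_right hdiv] using h
    · exact QuantumQuery.isMaxSumProb_of_le G hM hqM
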